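/- Let $p$ be an odd prime, let $v_p$ be the $p$-adic valuation on $\mathbb{Q}_p$ ($v_p(0)=\infty$), and let $f = X^p + a_{p-1}X^{p-1}+\dots+a_1X+a_0$ be an Eisenstein polynomial over $\mathbb{Q}_p$ (all $a_i\in p\mathbb{Z}_p$, $v_p(a_0)=1$). For polynomials $g,h$ over $\mathbb{Q}_p$ write $g\sim h$ if $\mathbb{Q}_p[X]/(g)\cong\mathbb{Q}_p[X]/(h)$ as $\mathbb{Q}_p$-algebras. Say that $f$ is of type $\langle\lambda\rangle$ if $\lambda=\min\{1\le i\le p-1 : v_p(a_i)=1\}$ (the set being non-empty), and of type $\langle 0\rangle$ if $v_p(a_i)\ge 2$ for all $1\le i\le p-1$. If $a_i\ne0$, put $u_i = a_i/p^{v_p(a_i)}\in\mathbb{Z}_p^\times$. For $n\ge1$ and $x\in\mathbb{Z}_p$ with $p^n\nmid x$, let $\langle x \bmod p^n\rangle$ be the integer $i$ with $x\equiv i\pmod{p^n}$ and $1\le i\le p^n-1$. Put $$u=\langle u_0^{-1}\bmod p\rangle,\quad a_0'=u^pa_0,\quad a_0''=a_0\{1+(u_0^{-1}u_1)^pa_0\}\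 (\text{if } a_1\neq 0),\quad u_\lambda'=u^{p-\lambda}u_\lambda,\quad a_\lambda'=u_\lambda'p.$$ (i) If $f$ is of type $\langle\lambda\rangle$, then $$f\sim\begin{cases} f_1:=X^p+\langle a_\lambda'\bmod p^2\rangle X^\lambda+p & \text{if }\lambda\ne p-1\text{ or }u'_\lambda\not\equiv-1\pmod p,\\ f_2:=X^p-pX^{p-1}+\langle a_0'\bmod p^3\rangle & \text{if }\lambda=p-1\text{ and }u'_\lambda\equiv-1\pmod p.\end{cases}$$ (ii) If $f$ is of type $\langle0\rangle$, then $$f\sim\begin{cases} f_3:=X^p+\langle a_0'\bmod p^3\rangle & \text{if }v_p(a_1)\ne2,\\ f_4:=X^p+\langle a_0''\bmod p^3\rangle & \text{if }v_p(a_1)=2.\end{cases}$$ Moreover, in the respective cases, the polynomials $f_1,f_2,f_3$ belong to Amano's table, which consists of the polynomials - $X^p+apX^\lambda+p$ with $1\le a\le p-1$, $1\le\lambda\le p-1$, $(\lambda,a)\ne(p-1,p-1)$; - $X^p-pX^{p-1}+(1+ap)p$ with $0\le a\le p-1$; - $X^p+(1+ap)p$ with $0\le a\le p-1$. In the last case,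 also $f\sim X^p+\langle u^pa_0''\bmod p^3\rangle$, and this polynomial belongs to Amano's table. -/

import Mathlib

open Polynomial

namespace EisensteinDegreeP

variable {p : ℕ} [Fact p.Prime]

/-- The set of (monic) Eisenstein polynomials of degree `e` over `ℚ_[p]`; their coefficients
lie in `ℤ_[p]`. -/
def eisensteinPolys (p : ℕ) [Fact p.Prime] (e : ℕ) : Set ℤ_[p][X] :=
  {f | f.Monic ∧ f.natDegree = e ∧ f.IsEisensteinAt (IsLocalRing.maximalIdeal ℤ_[p])}

/-- The `ℚ_[p]`-algebra `L_f = ℚ_[p][X] / (f)`. -/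
abbrev ExtensionOf (f : ℤ_[p][X]) : Type :=
  AdjoinRoot (f.map (algebraMap ℤ_[p] ℚ_[p]))

/-- `f` and `g` define the same extension: `L_f` and `L_g` are isomorphic over `ℚ_[p]`. -/
def SameExtension (f g : ℤ_[p][X]) : Prop :=
  Nonempty (ExtensionOf f ≃ₐ[ℚ_[p]] ExtensionOf g)

/-- The `p`-adic valuation on `ℤ_[p]`, with value `⊤` at `0`. -/
noncomputable def vp (a : ℤ_[p]) : ℕ∞ := emultiplicity (p : ℤ_[p]) a

/-- `f` is of type `⟨l⟩`, where `1 ≤ l ≤ p - 1`. -/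
def IsOfType (f : ℤ_[p][X]) (l : ℕ) : Prop :=
  IsLeast {i : ℕ | 1 ≤ i ∧ i ≤ p - 1 ∧ vp (f.coeff i) = 1} l

/-- `f` is of type `⟨0⟩`. -/
def IsOfTypeZero (f : ℤ_[p][X]) : Prop :=
  ∀ i : ℕ, 1 ≤ i → i ≤ p - 1 → 2 ≤ vp (f.coeff i)

open Classical in
/-- The unit `a / p ^ v_p(a)` for `a ≠ 0`; the value at `a = 0` is irrelevant. -/
noncomputable def unitPart (a : ℤ_[p]) : ℤ_[p]ˣ :=
  if h : a = 0 then 1 else PadicInt.unitCoeff h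

/-- `⟨x mod p ^ n⟩`: the integer in `[0, p ^ n - 1]` congruent to `x` modulo `p ^ n`. It lies in
`[1, p ^ n - 1]` as soon as `p ^ n` does not divide `x`. -/
noncomputable def residue (x : ℤ_[p]) (n : ℕ) : ℕ := (PadicInt.toZModPow n x).val

/-- `u = ⟨u₀⁻¹ mod p⟩`. -/
noncomputable def u (f : ℤ_[p][X]) : ℕ :=
  residue (((unitPart (f.coeff 0))⁻¹ : ℤ_[p]ˣ) : ℤ_[p]) 1

/-- `a₀' = u ^ p * a₀`. -/
noncomputable def a₀' (f : ℤ_[p][X]) : ℤ_[p] := (u f : ℤ_[p]) ^ p * f.coeff 0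

/-- `a₀'' = a₀ * (1 + (u₀⁻¹ * u₁) ^ p * a₀)`. -/
noncomputable def a₀'' (f : ℤ_[p][X]) : ℤ_[p] :=
  f.coeff 0 * (1 +
    (((unitPart (f.coeff 0))⁻¹ * unitPart (f.coeff 1) : ℤ_[p]ˣ) : ℤ_[p]) ^ p * f.coeff 0)

/-- `u'_l = u ^ (p - l) * u_l`. -/
noncomputable def u' (f : ℤ_[p][X]) (l : ℕ) : ℤ_[p] :=
  (u f : ℤ_[p]) ^ (p - l) * (unitPart (f.coeff l) : ℤ_[p])

/-- `a'_l = u'_l * p`. -/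
noncomputable def a' (f : ℤ_[p][X]) (l : ℕ) : ℤ_[p] := u' f l * (p : ℤ_[p])

noncomputable def f₁ (f : ℤ_[p][X]) (l : ℕ) : ℤ_[p][X] :=
  X ^ p + C (residue (a' f l) 2 : ℤ_[p]) * X ^ l + C (p : ℤ_[p])

noncomputable def f₂ (f : ℤ_[p][X]) : ℤ_[p][X] :=
  X ^ p - C (p : ℤ_[p]) * X ^ (p - 1) + C (residue (a₀' f) 3 : ℤ_[p])

noncomputable def f₃ (f : ℤ_[p][X]) : ℤ_[p][X] :=
  X ^ p + C (residue (a₀' f) 3 : ℤ_[p])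

noncomputable def f₄ (f : ℤ_[p][X]) : ℤ_[p][X] :=
  X ^ p + C (residue (a₀'' f) 3 : ℤ_[p])

/-- `f₄` rescaled by `u`, so that the constant term becomes congruent to `p` modulo `p ^ 2`. -/
noncomputable def f₄' (f : ℤ_[p][X]) : ℤ_[p][X] :=
  X ^ p + C (residue ((u f : ℤ_[p]) ^ p * a₀'' f) 3 : ℤ_[p])

/-- Membership in Amano's table of representatives. -/
def InAmanoTable (g : ℤ_[p][X]) : Prop :=
  (∃ a l : ℕ, 1 ≤ a ∧ a ≤ p - 1 ∧ 1 ≤ l ∧ l ≤ p - 1 ∧ (l, a) ≠ (p - 1, p - 1) ∧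
    g = X ^ p + C ((a : ℤ_[p]) * (p : ℤ_[p])) * X ^ l + C (p : ℤ_[p])) ∨
  (∃ a : ℕ, a ≤ p - 1 ∧
    g = X ^ p - C (p : ℤ_[p]) * X ^ (p - 1) +
      C ((1 + (a : ℤ_[p]) * (p : ℤ_[p])) * (p : ℤ_[p]))) ∨
  (∃ a : ℕ, a ≤ p - 1 ∧
    g = X ^ p + C ((1 + (a : ℤ_[p]) * (p : ℤ_[p])) * (p : ℤ_[p])))

end EisensteinDegreeP

/-! Let A = ℤ_p[X]/(f), with π the class of X. A root in A of an Eisenstein polynomial g of degree p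
embeds one field of degree p into another, so finding such a root suffices
(`sameExtension_of_root`). The ring A is π-adically complete, p = π^p ε with ε ≡ -1/u₀ mod π, and
every element is congruent mod π to one of ℤ_p. The relation f(π) = 0, stripped of its terms of high
π-order, makes uπ an approximate root of the target; the factor u makes the constant term ≡ p mod
p². It is refined by a Hensel argument in s, with y = π(x + π^m s).

Type ⟨λ⟩: the part linear in s has order p+λ+m with unit coefficient, and the p-th power of s has
order p+pm. If the former is smaller, Hensel's lemma applies. For λ = p-1, m = 1 they tie, and
modulo π the equation becomes c₀ + (b+1)s = 0 with b ≡ u'_λ; hence the exception u'_λ ≡ -1. There m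
= 2 works, at the price of needing the constant term mod p³.

Type ⟨0⟩: with m = 2 the linear part comes from p x^(p-1) and has order 2p+2, below 3p as p ≥ 3.
Modulo π^(2p+2) only π^p + a₀ survives in f(π), plus a₁π if v_p(a₁) = 2. In that case y = π(1 + πt)
with t = -u₁/u₀ has y^p ≡ π^p + a₁π + a₀²t^p, and the last term is absorbed in a₀''. -/

namespace EisensteinDegreeP

/-! ### Hensel's lemma in an adically complete ring -/

section Hensel

variable {R : Type*} [CommRing R]

/-- Hensel's lemma for a polynomial that need not be monic. -/
theorem exists_eval_eq_zero_of_isAdicComplete (ϖ : R) [IsAdicComplete (Ideal.span {ϖ}) R]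
    (F : R[X]) (s₀ : R) (h₀ : ϖ ∣ F.eval s₀) (h₁ : IsUnit (F.derivative.eval s₀)) :
    ∃ s, F.eval s = 0 := by
  obtain ⟨v, hv⟩ := h₁.exists_left_inv
  -- Newton iteration with the inverse derivative frozen at `s₀`; each step gains one factor `ϖ`.
  let c : ℕ → R := fun n => Nat.rec s₀ (fun _ b => b - v * F.eval b) n
  have hc : ∀ n, c (n + 1) = c n - v * F.eval (c n) := fun n => rfl
  have key : ∀ n, ϖ ∣ c n - s₀ ∧ ϖ ^ (n + 1) ∣ F.eval (c n) := by
    intro n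
    induction n with
    | zero => simpa [c] using h₀
    | succ n ih =>
      obtain ⟨ih₁, ih₂⟩ := ih
      have hd : ϖ ∣ F.eval (c n) := (dvd_pow_self ϖ n.succ_ne_zero).trans ih₂
      refine ⟨?_, ?_⟩
      · rw [hc, sub_right_comm]
        exact dvd_sub ih₁ (hd.mul_left v)
      · obtain ⟨k, hk⟩ := F.binomExpansion (c n) (-(v * F.eval (c n)))
        obtain ⟨d, hd'⟩ := ih₁.trans (sub_dvd_eval_sub (c n) s₀ F.derivative)
        obtain ⟨a, ha⟩ := ih₂
        obtain ⟨b, hb⟩ := hd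
        rw [hc, sub_eq_add_neg, hk]
        refine ⟨-(d * a * v) + k * v ^ 2 * a * b, ?_⟩
        rw [pow_succ]
        linear_combination (-(v * F.eval (c n))) * hd' - F.eval (c n) * hv - ϖ * d * v * ha +
          k * v ^ 2 * F.eval (c n) * hb + k * v ^ 2 * ϖ * b * ha
  have hcauchy : ∀ {m n}, m ≤ n → c m ≡ c n [SMOD (Ideal.span {ϖ} ^ m • ⊤ : Ideal R)] := by
    intro m n hmn
    rw [smul_eq_mul, Ideal.mul_top, Ideal.span_singleton_pow]
    induction n, hmn using Nat.le_induction with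
    | base => rfl
    | succ n hmn ih =>
      refine ih.trans ?_
      rw [SModEq.sub_mem, Ideal.mem_span_singleton, hc, sub_sub_cancel]
      exact ((pow_dvd_pow ϖ (hmn.trans n.le_succ)).trans (key n).2).mul_left v
  obtain ⟨s, hs⟩ := IsPrecomplete.prec' c hcauchy
  refine ⟨s, IsHausdorff.haus' (I := Ideal.span {ϖ}) _ fun n => ?_⟩
  specialize hs n
  rw [smul_eq_mul, Ideal.mul_top, Ideal.span_singleton_pow] at hs ⊢
  refine (hs.symm.eval F).trans ?_
  rw [SModEq.zero, Ideal.mem_span_singleton]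
  exact (pow_dvd_pow ϖ n.le_succ).trans (key n).2

theorem isUnit_of_dvd_sub (ϖ : R) [IsAdicComplete (Ideal.span {ϖ}) R] {x y : R}
    (hx : IsUnit x) (h : ϖ ∣ y - x) : IsUnit y := by
  obtain ⟨v, hv⟩ := hx.exists_left_inv
  obtain ⟨d, hd⟩ := h
  have hj : ϖ ∈ (⊥ : Ideal R).jacobson :=
    IsAdicComplete.le_jacobson_bot _ (Ideal.mem_span_singleton_self ϖ)
  rw [Ideal.mem_jacobson_bot] at hj
  refine isUnit_of_mul_isUnit_right (x := v) ?_
  convert hj (v * d) using 1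
  linear_combination v * hd + hv

end Hensel

/-! ### Refining approximate roots of trinomials and binomials -/

section Roots

variable {R : Type*} [CommRing R] {p : ℕ}

theorem exists_add_pow_prime_eq (hp : p.Prime) (x z : R) :
    ∃ q, (x + z) ^ p = x ^ p + z ^ p + p * (x ^ (p - 1) * z + z ^ 2 * q) := by
  have h2 := hp.two_le
  -- The index `p - 1` gives the part linear in `z`; every smaller index contributes a multiple of
  -- `z ^ 2`.
  have hmem : p - 1 ∈ Finset.Ioo 0 p := by rw [Finset.mem_Ioo]; omega
  have hS : z ∣ ∑ k ∈ (Finset.Ioo 0 p).erase (p - 1),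
      x ^ (k - 1) * z ^ (p - k - 1) * ((p.choose k / p : ℕ) : R) := by
    refine Finset.dvd_sum fun k hk => ?_
    rw [Finset.mem_erase, Finset.mem_Ioo] at hk
    exact ((dvd_pow_self z (by omega)).mul_left _).mul_right _
  obtain ⟨q, hq⟩ := hS
  refine ⟨x * q, ?_⟩
  have h1 : p - (p - 1) - 1 = 0 := by omega
  have h3 : p.choose (p - 1) / p = 1 := by
    rw [Nat.choose_symm (by omega : 1 ≤ p), Nat.choose_one_right, Nat.div_self hp.pos]
  rw [add_pow_prime_eq hp, ← Finset.add_sum_erase _ _ hmem, hq, h1, h3]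
  have h4 : x ^ (p - 1) = x * x ^ (p - 1 - 1) := by
    rw [← pow_succ', Nat.sub_add_cancel (by omega)]
  rw [h4]
  push_cast
  ring

variable (ϖ : R) [IsAdicComplete (Ideal.span {ϖ}) R]

/-- Since `ϖ ∣ p`, the derivative is `e` modulo `ϖ`, so any solution modulo `ϖ` lifts. -/
theorem exists_root_of_linear_part (c₀ e d s₀ : R) (hp : ϖ ∣ (p : R)) (he : IsUnit e) (H : R[X])
    (hs : ϖ ∣ c₀ + e * s₀ + d * s₀ ^ p) :
    ∃ s, (C c₀ + C e * X + C d * X ^ p + C ϖ * H).eval s = 0 := by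
  refine exists_eval_eq_zero_of_isAdicComplete ϖ _ s₀ ?_ (isUnit_of_dvd_sub ϖ he ?_)
  · simpa using dvd_add hs (dvd_mul_right ϖ (H.eval s₀))
  · simp only [derivative_add, derivative_mul, derivative_C, derivative_X, derivative_X_pow,
      eval_add, eval_mul, eval_C, eval_X, eval_pow, eval_one, eval_zero]
    obtain ⟨k, hk⟩ := hp
    exact ⟨d * k * s₀ ^ (p - 1) + H.derivative.eval s₀, by
      linear_combination d * s₀ ^ (p - 1) * hk⟩

/-- Substitute `y = ϖ (x + ϖ ^ m s)` and divide by `ϖ ^ (p + l + m)`. The term in `s ^ p` keeps a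
factor `ϖ ^ r`, while the cross terms of the `p`-th power (order at least `2p + m`) and the
quadratic terms of the `l`-th power (order at least `p + l + 2m`) vanish modulo `ϖ`. -/
theorem exists_root_trinomial (hp : p.Prime) {ε x b A c₀ s₀ : R} {l m r : ℕ}
    (hε : (p : R) = ϖ ^ p * ε) (hlp : l < p) (hm : 1 ≤ m)
    (hr : p * m = l + m + r) (he : IsUnit (b * ε * l * x ^ (l - 1)))
    (h : (ϖ * x) ^ p + b * p * (ϖ * x) ^ l + A = ϖ ^ (p + l + m) * c₀)
    (hs : ϖ ∣ c₀ + (b * ε * l * x ^ (l - 1)) * s₀ + ϖ ^ r * s₀ ^ p) :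
    ∃ y, y ^ p + b * p * y ^ l + A = 0 := by
  obtain ⟨q, hq⟩ := Nat.exists_eq_add_of_lt hlp
  obtain ⟨k, rfl⟩ := Nat.exists_eq_add_of_le' hm
  have hdvd : ϖ ∣ (p : R) := hε ▸ (dvd_pow_self ϖ hp.ne_zero).mul_right ε
  obtain ⟨Q, hQ⟩ := exists_add_pow_prime_eq hp (C x) (C (ϖ ^ (k + 1)) * X)
  obtain ⟨T, hT⟩ := powAddExpansion (C x) (C (ϖ ^ (k + 1)) * X) l
  obtain ⟨s, hs⟩ := exists_root_of_linear_part ϖ c₀ _ _ s₀ hdvd he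
    (C (ϖ ^ q * ε) * (C (x ^ (p - 1)) * X + C (ϖ ^ (k + 1)) * X ^ 2 * Q) +
      C (b * ε * ϖ ^ k) * X ^ 2 * T) hs
  have hQ' := congrArg (eval s) hQ
  have hT' := congrArg (eval s) hT
  simp only [eval_add, eval_mul, eval_C, eval_X, eval_pow, eval_natCast] at hQ' hT' hs
  refine ⟨ϖ * (x + ϖ ^ (k + 1) * s), ?_⟩
  have h1 : ϖ ^ p = ϖ ^ l * ϖ ^ q * ϖ := by rw [← pow_add, ← pow_succ, ← hq]
  have h2 : (ϖ ^ (k + 1) * s) ^ p = ϖ ^ l * ϖ ^ (k + 1) * ϖ ^ r * s ^ p := by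
    rw [mul_pow, ← pow_mul, mul_comm (k + 1) p, hr, pow_add, pow_add]
  rw [mul_pow, mul_pow, hQ', hT', h2]
  rw [mul_pow, mul_pow, pow_add, pow_add] at h
  rw [hε] at h ⊢
  have h3 : ϖ ^ (k + 1) = ϖ ^ k * ϖ := pow_succ ϖ k
  simp only [h3] at *
  generalize ϖ ^ p = P at *
  linear_combination h + P * ϖ ^ l * (ϖ ^ k * ϖ) * hs +
    P * ε * (x ^ (p - 1) * (ϖ ^ k * ϖ * s) + (ϖ ^ k * ϖ * s) ^ 2 * eval s Q) * h1

theorem exists_root_pow_add (hp : p.Prime) (hp2 : p ≠ 2) {ε x A : R}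
    (hε : (p : R) = ϖ ^ p * ε) (he : IsUnit ε) (hx : IsUnit x)
    (h : ϖ ^ (2 * p + 2) ∣ (ϖ * x) ^ p + A) :
    ∃ y, y ^ p + A = 0 := by
  have h3 : 3 ≤ p := by have := hp.two_le; omega
  -- The `s ^ p` term has excess order `3p - (2p + 2) = p - 2 = q + 1`, positive because `p ≥ 3`.
  obtain ⟨q, rfl⟩ := Nat.exists_eq_add_of_le' h3
  have hdvd : ϖ ∣ ((q + 3 : ℕ) : R) := hε ▸ (dvd_pow_self ϖ hp.ne_zero).mul_right ε
  obtain ⟨c₀, h⟩ := h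
  obtain ⟨Q, hQ⟩ := exists_add_pow_prime_eq hp (C x) (C (ϖ ^ 2) * X)
  have hu : IsUnit (ε * x ^ (q + 3 - 1)) := he.mul (hx.pow _)
  obtain ⟨v, hv⟩ := hu.exists_right_inv
  obtain ⟨s, hs⟩ := exists_root_of_linear_part (p := q + 3) ϖ c₀ _ (ϖ ^ (q + 1)) (-(v * c₀)) hdvd hu
    (C (ε * ϖ) * X ^ 2 * Q) (by
      have : c₀ + ε * x ^ (q + 3 - 1) * (-(v * c₀)) = 0 := by linear_combination (-c₀) * hv
      rw [this, zero_add]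
      exact (dvd_pow_self ϖ q.succ_ne_zero).mul_right _)
  have hQ' := congrArg (eval s) hQ
  simp only [eval_add, eval_mul, eval_C, eval_X, eval_pow, eval_natCast] at hQ' hs
  refine ⟨ϖ * (x + ϖ ^ 2 * s), ?_⟩
  rw [mul_pow, hQ', hε]
  rw [mul_pow] at h
  have h2 : (ϖ ^ 2 * s) ^ (q + 3) = ϖ ^ (q + 3) * ϖ ^ 2 * ϖ ^ (q + 1) * s ^ (q + 3) := by
    rw [mul_pow, ← pow_mul, ← pow_add, ← pow_add]
    congr 2
    ring
  rw [h2]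
  have h4 : ϖ ^ (2 * (q + 3) + 2) = ϖ ^ (q + 3) * ϖ ^ (q + 3) * ϖ ^ 2 := by
    rw [← pow_add, ← pow_add]
    congr 1
    ring
  rw [h4] at h
  generalize ϖ ^ (q + 3) = P at *
  generalize x ^ (q + 3 - 1) = Y at *
  linear_combination h + P * P * ϖ ^ 2 * hs

end Roots

variable {p : ℕ} [Fact p.Prime]

theorem dvd_iff_mem_maximalIdeal {a : ℤ_[p]} :
    a ∈ IsLocalRing.maximalIdeal ℤ_[p] ↔ (p : ℤ_[p]) ∣ a := by
  rw [PadicInt.maximalIdeal_eq_span_p, Ideal.mem_span_singleton]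

/-! ### From a root to an isomorphism of extensions -/

section SameExtension

theorem irreducible_map_of_mem_eisensteinPolys {e : ℕ} (he : 0 < e) {f : ℤ_[p][X]}
    (hf : f ∈ eisensteinPolys p e) : Irreducible (f.map (algebraMap ℤ_[p] ℚ_[p])) := by
  obtain ⟨hm, hd, hE⟩ := hf
  rw [← hm.irreducible_iff_irreducible_map_fraction_map]
  exact hE.irreducible (IsLocalRing.maximalIdeal.isMaximal _).isPrime hm.isPrimitive (hd ▸ he)

/-- Sending the class of `X` to `y` is a homomorphism of fields, hence injective, and both sides
have dimension `e`. -/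
theorem sameExtension_of_root {e : ℕ} (he : 0 < e) {f g : ℤ_[p][X]}
    (hf : f ∈ eisensteinPolys p e) (hg : g ∈ eisensteinPolys p e)
    (y : AdjoinRoot f) (hy : aeval y g = 0) : SameExtension f g := by
  have hgi : Fact (Irreducible (g.map (algebraMap ℤ_[p] ℚ_[p]))) :=
    ⟨irreducible_map_of_mem_eisensteinPolys he hg⟩
  have hfi : Fact (Irreducible (f.map (algebraMap ℤ_[p] ℚ_[p]))) :=
    ⟨irreducible_map_of_mem_eisensteinPolys he hf⟩
  let φ : AdjoinRoot f →+* ExtensionOf f := AdjoinRoot.map (algebraMap ℤ_[p] ℚ_[p]) f _ dvd_rfl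
  have hφ : φ.comp (algebraMap ℤ_[p] (AdjoinRoot f)) =
      (algebraMap ℚ_[p] (ExtensionOf f)).comp (algebraMap ℤ_[p] ℚ_[p]) := by
    ext a
    simp [φ, AdjoinRoot.algebraMap_eq, AdjoinRoot.map_of]
  have hroot : aeval (φ y) (g.map (algebraMap ℤ_[p] ℚ_[p])) = 0 := by
    rw [aeval_def, eval₂_map, ← hφ, ← hom_eval₂, ← aeval_def, hy, map_zero]
  let ψ : ExtensionOf g →ₐ[ℚ_[p]] ExtensionOf f :=
    AdjoinRoot.liftAlgHom _ (Algebra.ofId _ _) (φ y) hroot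
  have hinj : Function.Injective ψ := ψ.toRingHom.injective
  have hfr : ∀ {h : ℤ_[p][X]}, h ∈ eisensteinPolys p e →
      Module.Finite ℚ_[p] (ExtensionOf h) ∧ Module.finrank ℚ_[p] (ExtensionOf h) = e := by
    intro h hh
    have pb := AdjoinRoot.powerBasis' (hh.1.map (algebraMap ℤ_[p] ℚ_[p]))
    have hpb : (AdjoinRoot.powerBasis' (hh.1.map (algebraMap ℤ_[p] ℚ_[p]))).dim = e := by
      rw [AdjoinRoot.powerBasis'_dim, hh.1.natDegree_map, hh.2.1]
    exact ⟨pb.finite, (PowerBasis.finrank _).trans hpb⟩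
  have := (hfr hf).1
  have := (hfr hg).1
  have hsurj : Function.Surjective ψ :=
    (LinearMap.injective_iff_surjective_of_finrank_eq_finrank (f := ψ.toLinearMap)
      ((hfr hg).2.trans (hfr hf).2.symm)).mp hinj
  exact ⟨(AlgEquiv.ofBijective ψ ⟨hinj, hsurj⟩).symm⟩

end SameExtension

/-! ### Adic completeness of finite free algebras -/

section Completeness

/-- A finite free `ℤ_[p]`-algebra is `ϖ`-adically complete whenever `ϖ` and `p` generate the same
topology. -/
theorem isAdicComplete_span_of_basis {A ι : Type*} [CommRing A] [Algebra ℤ_[p] A] [Fintype ι]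
    (b : Module.Basis ι ℤ_[p] A) {ϖ : A} {n : ℕ} (hn : n ≠ 0) (h₁ : (p : A) ∣ ϖ ^ n)
    (h₂ : ϖ ∣ (p : A)) : IsAdicComplete (Ideal.span {ϖ}) A := by
  have hcast : ∀ (k : ℕ) (a : A), (p : A) ^ k * a = (p : ℤ_[p]) ^ k • a := by
    intro k a
    rw [Algebra.smul_def, map_pow, map_natCast]
  have hrepr : ∀ (k : ℕ) (a : A), ϖ ^ (n * k) ∣ a → ∀ i, (p : ℤ_[p]) ^ k ∣ b.repr a i := by
    intro k a ha i
    obtain ⟨c, rfl⟩ := ((pow_dvd_pow_of_dvd h₁ k).trans (by rw [pow_mul])).trans ha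
    rw [hcast, map_smul]
    exact ⟨b.repr c i, rfl⟩
  have hZ : IsAdicComplete (Ideal.span {(p : ℤ_[p])}) ℤ_[p] := by
    rw [← PadicInt.maximalIdeal_eq_span_p]
    infer_instance
  refine { haus' := fun x hx => ?_, prec' := fun c hc => ?_ }
  · simp only [smul_eq_mul, Ideal.mul_top, Ideal.span_singleton_pow, SModEq.zero,
      Ideal.mem_span_singleton] at hx
    refine b.ext_elem fun i => ?_
    rw [map_zero, Finsupp.zero_apply]
    refine hZ.haus' _ fun k => ?_
    rw [smul_eq_mul, Ideal.mul_top, Ideal.span_singleton_pow, SModEq.zero,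
      Ideal.mem_span_singleton]
    exact hrepr k x (hx _) i
  · simp only [smul_eq_mul, Ideal.mul_top, Ideal.span_singleton_pow, SModEq.sub_mem,
      Ideal.mem_span_singleton] at hc ⊢
    -- Limits are taken coordinatewise along the indices `n * k`, where divisibility by `ϖ ^ (n *
    -- k)` yields divisibility by `p ^ k`.
    have hlim : ∀ i, ∃ t : ℤ_[p], ∀ k, (p : ℤ_[p]) ^ k ∣ b.repr (c (n * k)) i - t := by
      intro i
      obtain ⟨t, ht⟩ := hZ.prec' (fun k => b.repr (c (n * k)) i) (by
        intro m k hmk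
        rw [smul_eq_mul, Ideal.mul_top, Ideal.span_singleton_pow, SModEq.sub_mem,
          Ideal.mem_span_singleton, ← Finsupp.sub_apply, ← map_sub]
        exact hrepr m _ (hc (Nat.mul_le_mul_left n hmk)) i)
      refine ⟨t, fun k => ?_⟩
      have := ht k
      rwa [smul_eq_mul, Ideal.mul_top, Ideal.span_singleton_pow, SModEq.sub_mem,
          Ideal.mem_span_singleton] at this
    choose t ht using hlim
    refine ⟨∑ i, t i • b i, fun k => ?_⟩
    have h3 : ϖ ^ k ∣ c (n * k) - ∑ i, t i • b i := by
      rw [← b.sum_repr (c (n * k)), ← Finset.sum_sub_distrib]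
      refine Finset.dvd_sum fun i _ => ?_
      obtain ⟨d, hd⟩ := ht i k
      rw [← sub_smul, hd, mul_smul, ← hcast]
      exact (pow_dvd_pow_of_dvd h₂ k).mul_right _
    have h4 := dvd_add (hc (Nat.le_mul_of_pos_left k (Nat.pos_of_ne_zero hn))) h3
    rwa [sub_add_sub_cancel] at h4

end Completeness

/-! ### The class of X as a uniformizer -/

section Uniformizer

variable {f : ℤ_[p][X]} {n : ℕ}

theorem dvd_coeff_of_mem_eisensteinPolys (hf : f ∈ eisensteinPolys p n) {i : ℕ} (hi : i < n) :
    (p : ℤ_[p]) ∣ f.coeff i :=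
  dvd_iff_mem_maximalIdeal.mp (hf.2.2.mem (hf.2.1.symm ▸ hi))

theorem not_sq_dvd_coeff_zero (hf : f ∈ eisensteinPolys p n) : ¬ (p : ℤ_[p]) ^ 2 ∣ f.coeff 0 := by
  have := hf.2.2.notMem
  rwa [PadicInt.maximalIdeal_eq_span_p, Ideal.span_singleton_pow, Ideal.mem_span_singleton] at this

theorem exists_coeff_zero_eq (hf : f ∈ eisensteinPolys p n) (hn : n ≠ 0) :
    ∃ w : ℤ_[p]ˣ, f.coeff 0 = p * w := by
  obtain ⟨w, hw⟩ := dvd_coeff_of_mem_eisensteinPolys hf (Nat.pos_of_ne_zero hn)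
  have hu : IsUnit w := by
    by_contra h
    rw [← mem_nonunits_iff, ← IsLocalRing.mem_maximalIdeal, dvd_iff_mem_maximalIdeal] at h
    apply not_sq_dvd_coeff_zero hf
    rw [hw, sq]
    exact mul_dvd_mul_left _ h
  exact ⟨hu.unit, hw⟩

theorem root_pow_add_sum (hf : f ∈ eisensteinPolys p n) :
    AdjoinRoot.root f ^ n +
      ∑ i ∈ Finset.range n, AdjoinRoot.of f (f.coeff i) * AdjoinRoot.root f ^ i = 0 := by
  obtain ⟨hm, hd, -⟩ := hf
  have h := AdjoinRoot.eval₂_root f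
  rwa [eval₂_eq_sum_range, Finset.sum_range_succ, hm.coeff_natDegree, map_one, one_mul, hd,
    add_comm] at h

theorem natCast_dvd_root_pow (hf : f ∈ eisensteinPolys p n) :
    (p : AdjoinRoot f) ∣ AdjoinRoot.root f ^ n := by
  rw [eq_neg_of_add_eq_zero_left (root_pow_add_sum hf), dvd_neg]
  refine Finset.dvd_sum fun i hi => Dvd.dvd.mul_right ?_ _
  have := map_dvd (AdjoinRoot.of f)
    (dvd_coeff_of_mem_eisensteinPolys hf (Finset.mem_range.mp hi))
  rwa [map_natCast] at this

theorem root_dvd_natCast (hf : f ∈ eisensteinPolys p n) (hn : n ≠ 0) :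
    AdjoinRoot.root f ∣ (p : AdjoinRoot f) := by
  obtain ⟨w, hw⟩ := exists_coeff_zero_eq hf hn
  have h := root_pow_add_sum hf
  obtain ⟨k, rfl⟩ := Nat.exists_eq_succ_of_ne_zero hn
  rw [Finset.sum_range_succ', pow_zero, mul_one, ← add_assoc, hw, map_mul, map_natCast] at h
  have hd : AdjoinRoot.root f ∣ p * AdjoinRoot.of f w := by
    rw [eq_neg_of_add_eq_zero_right h, dvd_neg]
    refine dvd_add (dvd_pow_self _ hn) (Finset.dvd_sum fun i _ => ?_)
    exact (dvd_pow_self _ i.succ_ne_zero).mul_left _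
  exact ((w.isUnit.map (AdjoinRoot.of f)).dvd_mul_right).mp hd

theorem isAdicComplete_adjoinRoot (hf : f ∈ eisensteinPolys p n) (hn : n ≠ 0) :
    IsAdicComplete (Ideal.span {AdjoinRoot.root f}) (AdjoinRoot f) :=
  isAdicComplete_span_of_basis (AdjoinRoot.powerBasis' hf.1).basis hn
    (natCast_dvd_root_pow hf) (root_dvd_natCast hf hn)

/-- In `ℤ_[p][X] / (f)` the prime `p` is a unit times the `n`-th power of the class of `X`. -/
theorem exists_natCast_eq_root_pow_mul (hf : f ∈ eisensteinPolys p n) (hn : n ≠ 0)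
    {w : ℤ_[p]ˣ} (hw : f.coeff 0 = p * w) :
    ∃ ε : AdjoinRoot f, IsUnit ε ∧ (p : AdjoinRoot f) = AdjoinRoot.root f ^ n * ε ∧
      AdjoinRoot.root f ∣ ε * AdjoinRoot.of f w + 1 := by
  have := isAdicComplete_adjoinRoot hf hn
  have h := root_pow_add_sum hf
  obtain ⟨k, rfl⟩ := Nat.exists_eq_succ_of_ne_zero hn
  rw [Finset.sum_range_succ', pow_zero, mul_one, ← add_assoc, hw, map_mul, map_natCast] at h
  -- The middle terms lie in `(pπ)`, so `π ^ n = -p (w + π d)` and `ε = -(w + π d)⁻¹`.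
  have hd : (p : AdjoinRoot f) * AdjoinRoot.root f ∣
      ∑ i ∈ Finset.range k, AdjoinRoot.of f (f.coeff (i + 1)) * AdjoinRoot.root f ^ (i + 1) := by
    refine Finset.dvd_sum fun i hi => mul_dvd_mul ?_ (dvd_pow_self _ i.succ_ne_zero)
    have hi : i + 1 < k.succ := Nat.succ_lt_succ (Finset.mem_range.mp hi)
    have := map_dvd (AdjoinRoot.of f) (dvd_coeff_of_mem_eisensteinPolys hf hi)
    rwa [map_natCast] at this
  obtain ⟨d, hd⟩ := hd
  have hu : IsUnit (AdjoinRoot.of f w + AdjoinRoot.root f * d) :=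
    isUnit_of_dvd_sub (AdjoinRoot.root f) (w.isUnit.map (AdjoinRoot.of f)) ⟨d, by ring⟩
  obtain ⟨v, hv⟩ := hu.exists_right_inv
  refine ⟨-v, (IsUnit.of_mul_eq_one _ (by rw [mul_comm]; exact hv)).neg, ?_, ?_⟩
  · linear_combination v * h - (p : AdjoinRoot f) * hv - v * hd
  · exact ⟨d * v, by linear_combination (-1 : AdjoinRoot f) * hv⟩

theorem exists_root_dvd_sub_of (f : ℤ_[p][X]) (x : AdjoinRoot f) :
    ∃ a : ℤ_[p], AdjoinRoot.root f ∣ x - AdjoinRoot.of f a := by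
  obtain ⟨q, rfl⟩ := AdjoinRoot.mk_surjective x
  refine ⟨q.coeff 0, AdjoinRoot.mk f q.divX, ?_⟩
  have h := congrArg (AdjoinRoot.mk f) q.divX_mul_X_add
  rw [map_add, map_mul, AdjoinRoot.mk_X, AdjoinRoot.mk_C] at h
  linear_combination -h

/-- The terms of `f` that are small at the root may be dropped. -/
theorem root_pow_dvd_root_pow_add_sum (hf : f ∈ eisensteinPolys p n) {N : ℕ} {T : Finset ℕ}
    (hT : T ⊆ Finset.range n)
    (h : ∀ i < n, i ∉ T →
      AdjoinRoot.root f ^ N ∣ AdjoinRoot.of f (f.coeff i) * AdjoinRoot.root f ^ i) :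
    AdjoinRoot.root f ^ N ∣ AdjoinRoot.root f ^ n +
      ∑ i ∈ T, AdjoinRoot.of f (f.coeff i) * AdjoinRoot.root f ^ i := by
  have h₀ := root_pow_add_sum hf
  rw [← Finset.sum_sdiff hT, add_left_comm] at h₀
  rw [eq_neg_of_add_eq_zero_right h₀, dvd_neg]
  refine Finset.dvd_sum fun i hi => ?_
  rw [Finset.mem_sdiff, Finset.mem_range] at hi
  exact h i hi.1 hi.2

end Uniformizer

/-! ### Valuations, residues and the normalising factor u -/

section Arithmetic

theorem natCast_dvd_pow_sub_self (x : ℤ_[p]) : (p : ℤ_[p]) ∣ x ^ p - x := by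
  rw [← dvd_iff_mem_maximalIdeal, ← PadicInt.ker_toZMod, RingHom.mem_ker, map_sub, map_pow,
    ZMod.pow_card, sub_self]

theorem not_natCast_dvd_unit (w : ℤ_[p]ˣ) : ¬ (p : ℤ_[p]) ∣ w := by
  rw [← dvd_iff_mem_maximalIdeal, IsLocalRing.mem_maximalIdeal, mem_nonunits_iff, not_not]
  exact w.isUnit

theorem isUnit_of_not_natCast_dvd {a : ℤ_[p]} (h : ¬ (p : ℤ_[p]) ∣ a) : IsUnit a := by
  rwa [← dvd_iff_mem_maximalIdeal, IsLocalRing.mem_maximalIdeal, mem_nonunits_iff, not_not] at h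

theorem pow_dvd_natCast_iff (n a : ℕ) : (p : ℤ_[p]) ^ n ∣ a ↔ p ^ n ∣ a := by
  have := PadicInt.pow_p_dvd_int_iff (p := p) n a
  exact_mod_cast this

theorem eq_unitPart_mul_of_vp_eq {a : ℤ_[p]} {n : ℕ} (h : vp a = n) :
    a = unitPart a * (p : ℤ_[p]) ^ n := by
  have ha : a ≠ 0 := by
    rintro rfl
    simp [vp] at h
  have hs := PadicInt.unitCoeff_spec ha
  have hv : a.valuation = n := by
    have : vp a = a.valuation := by
      rw [vp, emultiplicity_eq_coe]
      refine ⟨⟨_, hs.trans (mul_comm _ _)⟩, fun hd => ?_⟩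
      have hp0 : (p : ℤ_[p]) ^ a.valuation ≠ 0 :=
        pow_ne_zero _ (by exact_mod_cast (Fact.out : p.Prime).ne_zero)
      have hd' : (p : ℤ_[p]) * (p : ℤ_[p]) ^ a.valuation ∣
          PadicInt.unitCoeff ha * (p : ℤ_[p]) ^ a.valuation := by
        rwa [← pow_succ', ← hs]
      exact not_natCast_dvd_unit _ ((mul_dvd_mul_iff_right hp0).mp hd')
    rw [h] at this
    exact_mod_cast this.symm
  rw [unitPart, dif_neg ha, ← hv]
  exact hs

theorem pow_dvd_iff_le_vp {a : ℤ_[p]} {n : ℕ} : (p : ℤ_[p]) ^ n ∣ a ↔ (n : ℕ∞) ≤ vp a :=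
  pow_dvd_iff_le_emultiplicity

theorem vp_eq_one_iff {a : ℤ_[p]} : vp a = 1 ↔ (p : ℤ_[p]) ∣ a ∧ ¬ (p : ℤ_[p]) ^ 2 ∣ a := by
  have := emultiplicity_eq_coe (a := (p : ℤ_[p])) (b := a) (n := 1)
  simpa [vp] using this

theorem residue_lt (x : ℤ_[p]) (n : ℕ) : residue x n < p ^ n :=
  have : NeZero (p ^ n) := ⟨pow_ne_zero _ (Fact.out : p.Prime).ne_zero⟩
  ZMod.val_lt _

theorem pow_dvd_sub_residue (x : ℤ_[p]) (n : ℕ) : (p : ℤ_[p]) ^ n ∣ x - residue x n := by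
  have : NeZero (p ^ n) := ⟨pow_ne_zero _ (Fact.out : p.Prime).ne_zero⟩
  rw [← Ideal.mem_span_singleton, ← PadicInt.ker_toZModPow, RingHom.mem_ker, map_sub, map_natCast,
    residue, ZMod.natCast_zmod_val, sub_self]

variable {f : ℤ_[p][X]}

theorem coeff_zero_eq (hf : f ∈ eisensteinPolys p p) :
    f.coeff 0 = p * (unitPart (f.coeff 0) : ℤ_[p]) := by
  have hv : vp (f.coeff 0) = ((1 : ℕ) : ℕ∞) := vp_eq_one_iff.mpr
    ⟨dvd_coeff_of_mem_eisensteinPolys hf (Fact.out : p.Prime).pos, not_sq_dvd_coeff_zero hf⟩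
  have := eq_unitPart_mul_of_vp_eq hv
  rwa [pow_one, mul_comm] at this

theorem natCast_dvd_u_mul_sub_one (f : ℤ_[p][X]) :
    (p : ℤ_[p]) ∣ u f * (unitPart (f.coeff 0) : ℤ_[p]) - 1 := by
  obtain ⟨k, hk⟩ := pow_dvd_sub_residue (((unitPart (f.coeff 0))⁻¹ : ℤ_[p]ˣ) : ℤ_[p]) 1
  refine ⟨-(k * unitPart (f.coeff 0)), ?_⟩
  rw [u]
  linear_combination (-(unitPart (f.coeff 0) : ℤ_[p])) * hk + (unitPart (f.coeff 0)).inv_mul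

theorem natCast_dvd_u_pow_mul_sub_one (f : ℤ_[p][X]) :
    (p : ℤ_[p]) ∣ (u f : ℤ_[p]) ^ p * (unitPart (f.coeff 0) : ℤ_[p]) - 1 := by
  have h := dvd_add ((natCast_dvd_pow_sub_self (u f : ℤ_[p])).mul_right
    (unitPart (f.coeff 0) : ℤ_[p])) (natCast_dvd_u_mul_sub_one f)
  convert h using 1
  ring

theorem isUnit_u (f : ℤ_[p][X]) : IsUnit (u f : ℤ_[p]) := by
  refine isUnit_of_not_natCast_dvd fun h => not_natCast_dvd_unit (1 : ℤ_[p]ˣ) ?_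
  have := dvd_sub (h.mul_right (unitPart (f.coeff 0) : ℤ_[p])) (natCast_dvd_u_mul_sub_one f)
  simpa using this

theorem isUnit_u' (f : ℤ_[p][X]) (l : ℕ) : IsUnit (u' f l) :=
  ((isUnit_u f).pow _).mul (Units.isUnit _)

theorem sq_dvd_a₀'_sub (hf : f ∈ eisensteinPolys p p) : (p : ℤ_[p]) ^ 2 ∣ a₀' f - p := by
  obtain ⟨k, hk⟩ := natCast_dvd_u_pow_mul_sub_one f
  refine ⟨k, ?_⟩
  rw [a₀', coeff_zero_eq hf]
  linear_combination (p : ℤ_[p]) * hk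

theorem sq_dvd_u_pow_mul_a₀''_sub (hf : f ∈ eisensteinPolys p p) :
    (p : ℤ_[p]) ^ 2 ∣ (u f : ℤ_[p]) ^ p * a₀'' f - p := by
  obtain ⟨k, hk⟩ := sq_dvd_a₀'_sub hf
  obtain ⟨w, hw⟩ : (p : ℤ_[p]) ∣ f.coeff 0 := ⟨_, coeff_zero_eq hf⟩
  rw [a₀'] at hk
  rw [a₀'']
  generalize (((unitPart (f.coeff 0))⁻¹ * unitPart (f.coeff 1) : ℤ_[p]ˣ) : ℤ_[p]) ^ p = t
  rw [hw] at hk ⊢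
  exact ⟨k + (u f : ℤ_[p]) ^ p * w ^ 2 * t, by linear_combination hk⟩

/-- A residue modulo `p ^ 3` of something congruent to `p` modulo `p ^ 2`. -/
theorem exists_residue_eq {x : ℤ_[p]} (hx : (p : ℤ_[p]) ^ 2 ∣ x - p) :
    ∃ a : ℕ, a ≤ p - 1 ∧
      (residue x 3 : ℤ_[p]) = (1 + (a : ℤ_[p]) * (p : ℤ_[p])) * (p : ℤ_[p]) := by
  have hpos : 1 < p := (Fact.out : p.Prime).one_lt
  have h₁ : (p : ℤ_[p]) ^ 2 ∣ ((residue x 3 : ℤ) - (p : ℤ) : ℤ) := by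
    have := dvd_sub hx ((pow_dvd_pow (p : ℤ_[p]) (by norm_num : 2 ≤ 3)).trans
      (pow_dvd_sub_residue x 3))
    push_cast
    convert this using 1
    ring
  rw [PadicInt.pow_p_dvd_int_iff] at h₁
  obtain ⟨a, ha⟩ := h₁
  have hlt : (residue x 3 : ℤ) < (p : ℤ) ^ 3 := by exact_mod_cast residue_lt x 3
  have hpz : (1 : ℤ) < p := by exact_mod_cast hpos
  have ha0 : 0 ≤ a := by
    by_contra! h
    have : (0 : ℤ) ≤ residue x 3 := Int.natCast_nonneg _
    nlinarith
  have hap : a < p := by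
    by_contra! h
    nlinarith [sq_nonneg (p : ℤ)]
  lift a to ℕ using ha0
  refine ⟨a, by omega, ?_⟩
  have : (residue x 3 : ℤ) = (1 + a * p) * p := by linear_combination ha
  exact_mod_cast congrArg (Int.cast : ℤ → ℤ_[p]) this

/-- A residue modulo `p ^ 2` of a multiple of `p`. -/
theorem exists_residue_mul_eq {w : ℤ_[p]} (hw : ¬ (p : ℤ_[p]) ∣ w) :
    ∃ a : ℕ, 1 ≤ a ∧ a ≤ p - 1 ∧ (residue (w * (p : ℤ_[p])) 2 : ℤ_[p]) = a * p ∧ (p : ℤ_[p]) ∣ w - a := by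
  have hp0 : (p : ℤ_[p]) ≠ 0 := by exact_mod_cast (Fact.out : p.Prime).ne_zero
  have h := pow_dvd_sub_residue (w * (p : ℤ_[p])) 2
  have h₁ : (p : ℤ_[p]) ^ 1 ∣ residue (w * (p : ℤ_[p])) 2 := by
    rw [pow_one]
    have := dvd_sub (dvd_mul_left (p : ℤ_[p]) w) ((dvd_pow_self (p : ℤ_[p]) two_ne_zero).trans h)
    simpa using this
  rw [pow_dvd_natCast_iff, pow_one] at h₁
  obtain ⟨a, ha⟩ := h₁
  have hlt := residue_lt (w * (p : ℤ_[p])) 2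
  rw [ha, sq] at hlt
  have hap : a < p := lt_of_mul_lt_mul_left hlt (Nat.zero_le _)
  have hd : (p : ℤ_[p]) ∣ w - a := by
    obtain ⟨k, hk⟩ := h
    refine ⟨k, mul_right_cancel₀ hp0 ?_⟩
    rw [ha] at hk
    push_cast at hk
    linear_combination hk
  refine ⟨a, ?_, by omega, by rw [ha]; push_cast; ring, hd⟩
  rcases Nat.eq_zero_or_pos a with rfl | h0
  · simp [hw] at hd
  · exact h0

end Arithmetic

/-! ### Eisenstein trinomials -/

section Polynomials

theorem trinomial_mem_eisensteinPolys {b c : ℤ_[p]} {l : ℕ} (hl : 1 ≤ l) (hlp : l < p)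
    (hb : (p : ℤ_[p]) ∣ b) (hc : (p : ℤ_[p]) ∣ c) (hc' : ¬ (p : ℤ_[p]) ^ 2 ∣ c) :
    X ^ p + C b * X ^ l + C c ∈ eisensteinPolys p p := by
  have hdeg : (C b * X ^ l + C c).degree < (p : WithBot ℕ) := by
    refine (degree_add_le _ _).trans_lt (max_lt ?_ ?_)
    · exact (degree_C_mul_X_pow_le _ _).trans_lt (by exact_mod_cast hlp)
    · exact degree_C_le.trans_lt (by exact_mod_cast (Fact.out : p.Prime).pos)
  have hm : (X ^ p + C b * X ^ l + C c).Monic := by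
    rw [add_assoc]
    exact monic_X_pow_add hdeg
  have hnat : (X ^ p + C b * X ^ l + C c).natDegree = p := by
    refine natDegree_eq_of_degree_eq_some ?_
    rw [add_assoc, degree_add_eq_left_of_degree_lt (by rwa [degree_X_pow]), degree_X_pow]
  refine ⟨hm, hnat, ?_, ?_, ?_⟩
  · rw [hm.leadingCoeff, dvd_iff_mem_maximalIdeal]
    simpa using not_natCast_dvd_unit (1 : ℤ_[p]ˣ)
  · intro i hi
    rw [hnat] at hi
    rw [dvd_iff_mem_maximalIdeal]
    simp only [coeff_add, coeff_X_pow, coeff_C_mul, coeff_C, if_neg hi.ne, zero_add]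
    refine dvd_add (hb.mul_right _) ?_
    split_ifs
    · exact hc
    · exact dvd_zero _
  · rw [PadicInt.maximalIdeal_eq_span_p, Ideal.span_singleton_pow, Ideal.mem_span_singleton]
    simpa [coeff_X_pow, (Fact.out : p.Prime).ne_zero.symm, (show (0 : ℕ) ≠ l by omega),
      (Fact.out : p.Prime).ne_zero, (show l ≠ 0 by omega)] using hc'

end Polynomials

/-! ### Approximate roots from the relation f(π) = 0 -/

section Criteria

variable {f : ℤ_[p][X]}

theorem root_pow_dvd_of {n : ℕ} (hf : f ∈ eisensteinPolys p n) (hn : n ≠ 0) {a : ℤ_[p]} {k N i : ℕ}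
    (ha : (p : ℤ_[p]) ^ k ∣ a) (hN : N ≤ k * n + i) :
    AdjoinRoot.root f ^ N ∣ AdjoinRoot.of f a * AdjoinRoot.root f ^ i := by
  obtain ⟨w, hw⟩ := exists_coeff_zero_eq hf hn
  obtain ⟨ε, -, hε, -⟩ := exists_natCast_eq_root_pow_mul hf hn hw
  refine (pow_dvd_pow _ hN).trans ?_
  rw [pow_add]
  refine mul_dvd_mul_right (dvd_trans ?_ (map_dvd (AdjoinRoot.of f) ha)) _
  rw [map_pow, map_natCast, hε, mul_pow, ← pow_mul, mul_comm n]
  exact dvd_mul_right _ _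

theorem sq_dvd_of_vp_ne_one {a : ℤ_[p]} (ha : (p : ℤ_[p]) ∣ a) (h : vp a ≠ 1) :
    (p : ℤ_[p]) ^ 2 ∣ a := by
  by_contra h'
  exact h (vp_eq_one_iff.mpr ⟨ha, h'⟩)

/-- Terms with `0 < i < l` have `p ^ 2 ∣ a_i`, hence order at least `2p + 1`. Terms with `i > l`
have order at least `p + l + 1`, and exist only if `l + 1 < p`. -/
theorem root_pow_dvd_of_isOfType (hf : f ∈ eisensteinPolys p p) {l N : ℕ} (hl : IsOfType f l)
    (hN : N ≤ 2 * p + 1) (hN' : l + 1 < p → N ≤ p + l + 1) :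
    AdjoinRoot.root f ^ N ∣ AdjoinRoot.root f ^ p +
      (AdjoinRoot.of f (f.coeff l) * AdjoinRoot.root f ^ l + AdjoinRoot.of f (f.coeff 0)) := by
  have hp := (Fact.out : p.Prime)
  obtain ⟨⟨hl1, hlp, -⟩, hmin⟩ := hl
  have h := root_pow_dvd_root_pow_add_sum hf (N := N) (T := {l, 0}) (by
    intro i hi
    simp only [Finset.mem_insert, Finset.mem_singleton] at hi
    rw [Finset.mem_range]
    have := hp.pos
    omega) (by
    intro i hi hiT
    simp only [Finset.mem_insert, Finset.mem_singleton, not_or] at hiT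
    have hd := dvd_coeff_of_mem_eisensteinPolys hf hi
    rcases lt_or_gt_of_ne hiT.1 with h | h
    · refine root_pow_dvd_of hf hp.ne_zero (k := 2) (sq_dvd_of_vp_ne_one hd fun hv => ?_) (by omega)
      have := hmin (show i ∈ {i : ℕ | 1 ≤ i ∧ i ≤ p - 1 ∧ vp (f.coeff i) = 1} from
        ⟨by omega, by omega, hv⟩)
      omega
    · refine root_pow_dvd_of hf hp.ne_zero (k := 1) (by rwa [pow_one]) ?_
      have := hN' (by omega)
      omega)
  rwa [Finset.sum_pair (by omega), pow_zero, mul_one] at h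

/-- An approximate root of a trinomial, for `f` of type `⟨l⟩`. -/
theorem root_pow_dvd_trinomial (hf : f ∈ eisensteinPolys p p) {l N : ℕ} (hl : IsOfType f l)
    (hN : N ≤ 2 * p + 1) (hN' : l + 1 < p → N ≤ p + l + 1) {b c : ℤ_[p]} {k : ℕ}
    (hb : (p : ℤ_[p]) ∣ u' f l - b) (hc : (p : ℤ_[p]) ^ k ∣ a₀' f - c) (hk : N ≤ k * p) :
    AdjoinRoot.root f ^ N ∣ (AdjoinRoot.root f * AdjoinRoot.of f (u f)) ^ p +
      AdjoinRoot.of f b * p * (AdjoinRoot.root f * AdjoinRoot.of f (u f)) ^ l +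
      AdjoinRoot.of f c := by
  have hp := (Fact.out : p.Prime)
  obtain ⟨⟨hl1, hlp, hv⟩, -⟩ := id hl
  have h₁ := root_pow_dvd_of_isOfType hf hl hN hN'
  have h₂ := root_pow_dvd_of hf hp.ne_zero (N := N) (i := l) (k := 2) (a := (u' f l - b) * p)
    (by rw [sq]; exact mul_dvd_mul_right hb _) (by omega)
  have h₃ := root_pow_dvd_of hf hp.ne_zero (i := 0) hc hk
  have hal : f.coeff l = unitPart (f.coeff l) * p := by
    simpa using eq_unitPart_mul_of_vp_eq (n := 1) hv
  -- Multiplying the relation by `u ^ p` and splitting off `u ^ l` turns `π` into `uπ` and `u_l`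
  -- into `u'_l`.
  have hpow : AdjoinRoot.of f (u f) ^ p =
      AdjoinRoot.of f (u f) ^ (p - l) * AdjoinRoot.of f (u f) ^ l := by
    rw [← pow_add, Nat.sub_add_cancel (by omega)]
  have h₄ := dvd_sub (dvd_sub (h₁.mul_left (AdjoinRoot.of f (u f) ^ p))
    (h₂.mul_left (AdjoinRoot.of f (u f) ^ l))) h₃
  convert h₄ using 1
  rw [hal, u', a₀']
  simp only [map_mul, map_sub, map_pow, map_natCast] at hpow ⊢
  rw [hpow]
  ring_nf
  rw [hpow]
  ring

end Criteria

/-! ### Type ⟨λ⟩ -/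

section TypeLambda

variable {f : ℤ_[p][X]}

theorem isUnit_natCast_of_lt {l : ℕ} (hl : 1 ≤ l) (hlp : l < p) : IsUnit (l : ℤ_[p]) := by
  refine isUnit_of_not_natCast_dvd fun h => ?_
  rw [← pow_one (p : ℤ_[p]), pow_dvd_natCast_iff, pow_one] at h
  exact absurd (Nat.le_of_dvd hl h) (not_le.mpr hlp)

theorem natCast_dvd_u_pow_sub_one (f : ℤ_[p][X]) :
    (p : ℤ_[p]) ∣ (u f : ℤ_[p]) ^ (p - 1) - 1 := by
  have h := natCast_dvd_pow_sub_self (u f : ℤ_[p])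
  rw [← (isUnit_u f).dvd_mul_left]
  convert h using 1
  rw [mul_sub, mul_one, mul_pow_sub_one (Fact.out : p.Prime).ne_zero]

theorem dvd_and_not_sq_dvd_of_sq_dvd_sub {x y : ℤ_[p]} (hy : (p : ℤ_[p]) ∣ y)
    (hy' : ¬ (p : ℤ_[p]) ^ 2 ∣ y) (h : (p : ℤ_[p]) ^ 2 ∣ x - y) :
    (p : ℤ_[p]) ∣ x ∧ ¬ (p : ℤ_[p]) ^ 2 ∣ x := by
  refine ⟨?_, fun hd => hy' ?_⟩
  · have := dvd_add ((dvd_pow_self _ two_ne_zero).trans h) hy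
    rwa [sub_add_cancel] at this
  · have := dvd_sub hd h
    rwa [sub_sub_cancel] at this

theorem not_sq_dvd_natCast : ¬ (p : ℤ_[p]) ^ 2 ∣ (p : ℤ_[p]) := by
  have hp := (Fact.out : p.Prime)
  have := hp.two_le
  rw [pow_dvd_natCast_iff]
  intro h
  have := Nat.le_of_dvd hp.pos h
  nlinarith

theorem sameExtension_of_trinomial_root (hf : f ∈ eisensteinPolys p p) {l : ℕ} (hl : 1 ≤ l)
    (hlp : l < p) {b c : ℤ_[p]} (hb : (p : ℤ_[p]) ∣ b) (hc : (p : ℤ_[p]) ^ 2 ∣ c - p)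
    {y : AdjoinRoot f} (hy : y ^ p + AdjoinRoot.of f b * y ^ l + AdjoinRoot.of f c = 0) :
    SameExtension f (X ^ p + C b * X ^ l + C c) := by
  have hp := (Fact.out : p.Prime)
  obtain ⟨h₁, h₂⟩ := dvd_and_not_sq_dvd_of_sq_dvd_sub dvd_rfl not_sq_dvd_natCast hc
  refine sameExtension_of_root hp.pos hf (trinomial_mem_eisensteinPolys hl hlp hb h₁ h₂) y ?_
  simpa [AdjoinRoot.algebraMap_eq] using hy

theorem exists_mul_linear_eq {R : Type*} [CommRing R] {e : R} (he : IsUnit e) (c : R) :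
    ∃ s, c + e * s = 0 := by
  obtain ⟨v, hv⟩ := he.exists_right_inv
  exact ⟨-(v * c), by linear_combination (-c) * hv⟩

/-- Modulo `π`, `ε ≡ -u`, `p - 1 ≡ -1` and `u ^ (p - 1) ≡ 1`. This identifies the linear coefficient
in the tie case `l = p - 1`, `m = 1`. -/
theorem root_dvd_linear_coeff_sub (hf : f ∈ eisensteinPolys p p) {ε : AdjoinRoot f}
    (hε : AdjoinRoot.root f ∣ ε * AdjoinRoot.of f (unitPart (f.coeff 0) : ℤ_[p]) + 1)
    (b : ℤ_[p]) :
    AdjoinRoot.root f ∣ AdjoinRoot.of f b * ε * ((p - 1 : ℕ) : AdjoinRoot f) *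
      AdjoinRoot.of f (u f) ^ (p - 1 - 1) - AdjoinRoot.of f b := by
  have hp := (Fact.out : p.Prime)
  have hd := root_dvd_natCast hf hp.ne_zero
  have h₁ := map_dvd (AdjoinRoot.of f) (natCast_dvd_u_mul_sub_one f)
  have h₂ := map_dvd (AdjoinRoot.of f) (natCast_dvd_u_pow_sub_one f)
  rw [map_natCast, map_sub, map_mul, map_one] at h₁
  rw [map_natCast, map_sub, map_pow, map_one] at h₂
  have hpow : AdjoinRoot.of f (u f) ^ (p - 1) =
      AdjoinRoot.of f (u f) * AdjoinRoot.of f (u f) ^ (p - 1 - 1) := by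
    have := hp.two_le
    rw [← pow_succ', Nat.sub_add_cancel (by omega)]
  rw [hpow] at h₂
  have hcast : ((p - 1 : ℕ) : AdjoinRoot f) = p - 1 := by
    rw [Nat.cast_sub hp.one_le, Nat.cast_one]
  obtain ⟨α, hα⟩ := hd.trans h₁
  obtain ⟨β, hβ⟩ := hd.trans h₂
  obtain ⟨γ, hγ⟩ := hε
  obtain ⟨δ, hδ⟩ := hd
  rw [hcast]
  generalize AdjoinRoot.of f (u f) = U at *
  generalize U ^ (p - 1 - 1) = V at *
  generalize AdjoinRoot.of f (unitPart (f.coeff 0) : ℤ_[p]) = w at *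
  have hsum : ε + U = AdjoinRoot.root f * (U * γ - ε * α) := by
    linear_combination U * hγ - ε * hα
  refine ⟨AdjoinRoot.of f b *
    ((U * γ - ε * α) * ((p : AdjoinRoot f) - 1) * V - δ * U * V + β), ?_⟩
  linear_combination AdjoinRoot.of f b *
    (((p : AdjoinRoot f) - 1) * V * hsum - U * V * hδ + hβ)

/-- The common criterion behind all cases of positive type. -/
theorem sameExtension_trinomial (hf : f ∈ eisensteinPolys p p) {l m r k : ℕ} (hl : IsOfType f l)
    (hm : 1 ≤ m) (hr : p * m = l + m + r) (hN : p + l + m ≤ 2 * p + 1)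
    (hN' : l + 1 < p → m = 1) {b c : ℤ_[p]} (hb : (p : ℤ_[p]) ∣ u' f l - b)
    (hc : (p : ℤ_[p]) ^ k ∣ a₀' f - c) (hk : p + l + m ≤ k * p)
    (hcase : 1 ≤ r ∨ r = 0 ∧ l = p - 1 ∧ ¬ (p : ℤ_[p]) ∣ b + 1) :
    SameExtension f (X ^ p + C (b * p) * X ^ l + C c) := by
  have hp := (Fact.out : p.Prime)
  have h2 := hp.two_le
  have := isAdicComplete_adjoinRoot hf hp.ne_zero
  obtain ⟨⟨hl1, hlp, hv⟩, -⟩ := id hl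
  have hk2 : 2 ≤ k := by
    by_contra! h
    have : k * p ≤ 1 * p := Nat.mul_le_mul_right p (by omega)
    omega
  obtain ⟨ε, hεu, hε, hεw⟩ := exists_natCast_eq_root_pow_mul hf hp.ne_zero (coeff_zero_eq hf)
  obtain ⟨c₀, h⟩ := root_pow_dvd_trinomial hf hl hN (by omega) hb hc hk
  have hbu : IsUnit b := by
    refine isUnit_of_not_natCast_dvd fun hpb => ?_
    have := dvd_add hb hpb
    rw [sub_add_cancel] at this
    exact not_natCast_dvd_unit (isUnit_u' f l).unit this
  have he : IsUnit (AdjoinRoot.of f b * ε * (l : AdjoinRoot f) *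
      AdjoinRoot.of f (u f) ^ (l - 1)) := by
    refine (((hbu.map _).mul hεu).mul ?_).mul (((isUnit_u f).map _).pow _)
    have := (isUnit_natCast_of_lt hl1 (by omega : l < p)).map (AdjoinRoot.of f)
    rwa [map_natCast] at this
  obtain ⟨s₀, hs₀⟩ : ∃ s₀, AdjoinRoot.root f ∣ c₀ + (AdjoinRoot.of f b * ε * (l : AdjoinRoot f) *
      AdjoinRoot.of f (u f) ^ (l - 1)) * s₀ + AdjoinRoot.root f ^ r * s₀ ^ p := by
    rcases hcase with hr1 | ⟨rfl, rfl, hb1⟩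
    · obtain ⟨s₀, hs₀⟩ := exists_mul_linear_eq he c₀
      exact ⟨s₀, by
        rw [hs₀, zero_add]
        exact (dvd_pow_self _ (by omega)).mul_right _⟩
    -- Tie case: for `t` in `ℤ_[p]` one has `t ^ p ≡ t`, so the congruence is linear with
    -- coefficient `b + 1`, a unit.
    · obtain ⟨k, hk⟩ := exists_root_dvd_sub_of f c₀
      obtain ⟨t, ht⟩ := exists_mul_linear_eq (isUnit_of_not_natCast_dvd hb1) k
      refine ⟨AdjoinRoot.of f t, ?_⟩
      have h₁ := (root_dvd_linear_coeff_sub hf hεw b).mul_right (AdjoinRoot.of f t)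
      have h₂ := map_dvd (AdjoinRoot.of f) (natCast_dvd_pow_sub_self t)
      rw [map_natCast, map_sub, map_pow] at h₂
      have h₃ := congrArg (AdjoinRoot.of f) ht
      rw [map_add, map_mul, map_add, map_one, map_zero] at h₃
      have h₄ := dvd_add (dvd_add hk h₁) ((root_dvd_natCast hf hp.ne_zero).trans h₂)
      convert h₄ using 1
      linear_combination h₃
  obtain ⟨y, hy⟩ := exists_root_trinomial (AdjoinRoot.root f) hp hε (by omega) hm hr he h hs₀
  refine sameExtension_of_trinomial_root hf hl1 (by omega) (dvd_mul_left _ _) ?_ (y := y) ?_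
  · have := dvd_sub (sq_dvd_a₀'_sub hf) ((pow_dvd_pow _ hk2).trans hc)
    rwa [sub_sub_sub_cancel_left] at this
  · rwa [map_mul, map_natCast]

theorem sameExtension_f₁ (hf : f ∈ eisensteinPolys p p) {l : ℕ} (hl : IsOfType f l)
    (h : l ≠ p - 1 ∨ ¬ (p : ℤ_[p]) ∣ u' f l - (-1)) :
    SameExtension f (f₁ f l) ∧ InAmanoTable (f₁ f l) := by
  have hp := (Fact.out : p.Prime)
  have h2 := hp.two_le
  obtain ⟨⟨hl1, hlp, -⟩, -⟩ := id hl
  obtain ⟨a, ha1, hap, hres, ha⟩ := exists_residue_mul_eq (not_natCast_dvd_unit (isUnit_u' f l).unit)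
  rw [IsUnit.unit_spec] at hres ha
  have hf₁ : f₁ f l = X ^ p + C ((a : ℤ_[p]) * (p : ℤ_[p])) * X ^ l + C (p : ℤ_[p]) := by
    rw [f₁, a', hres]
  have hiff : ∀ x : ℤ_[p], (p : ℤ_[p]) ∣ x + 1 → (p : ℤ_[p]) ∣ u' f l - x →
      (p : ℤ_[p]) ∣ u' f l - (-1) := by
    intro x hx hx'
    convert dvd_add hx hx' using 1
    ring
  rw [hf₁]
  refine ⟨?_, Or.inl ⟨a, l, ha1, hap, hl1, hlp, ?_, rfl⟩⟩
  · refine sameExtension_trinomial hf hl (m := 1) (r := p - 1 - l) (k := 2) le_rfl (by omega)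
      (by omega) (fun _ => rfl) ha (sq_dvd_a₀'_sub hf) (by omega) ?_
    rcases eq_or_ne l (p - 1) with rfl | hne
    · exact Or.inr ⟨by omega, rfl, fun hd => h.resolve_left (by simp) (hiff _ hd ha)⟩
    · exact Or.inl (by omega)
  · rintro heq
    obtain ⟨rfl, rfl⟩ := Prod.mk.inj heq
    refine h.resolve_left (by simp) (hiff _ ?_ ha)
    rw [Nat.cast_sub hp.one_le, Nat.cast_one, sub_add_cancel]

theorem sameExtension_f₂ (hf : f ∈ eisensteinPolys p p) (hl : IsOfType f (p - 1))
    (h : (p : ℤ_[p]) ∣ u' f (p - 1) - (-1)) :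
    SameExtension f (f₂ f) ∧ InAmanoTable (f₂ f) := by
  have hp := (Fact.out : p.Prime)
  have h2 := hp.two_le
  obtain ⟨a, hap, ha⟩ := exists_residue_eq (sq_dvd_a₀'_sub hf)
  refine ⟨?_, Or.inr (Or.inl ⟨a, hap, by rw [f₂, ha]⟩)⟩
  -- With `m = 2` the tie disappears (`r = p - 1`), but order `2p + 1` is needed, so `a₀'` must be
  -- known modulo `p ^ 3`.
  have := sameExtension_trinomial hf hl (m := 2) (r := p - 1) (k := 3) one_le_two (by omega)
    (by omega) (by omega) h (pow_dvd_sub_residue (a₀' f) 3) (by omega) (Or.inl (by omega))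
  rwa [neg_one_mul, C_neg, neg_mul, ← sub_eq_add_neg] at this

end TypeLambda

/-! ### Type ⟨0⟩ -/

section TypeZero

variable {f : ℤ_[p][X]}

/-- The common criterion behind all cases of type `⟨0⟩`. -/
theorem sameExtension_pow_add (hf : f ∈ eisensteinPolys p p) (hp2 : p ≠ 2) {c c' : ℤ_[p]}
    {x : AdjoinRoot f} (hx : IsUnit x)
    (h : AdjoinRoot.root f ^ (2 * p + 2) ∣ (AdjoinRoot.root f * x) ^ p + AdjoinRoot.of f c)
    (hc : (p : ℤ_[p]) ^ 3 ∣ c - c') (hc' : (p : ℤ_[p]) ∣ c') (hc'' : ¬ (p : ℤ_[p]) ^ 2 ∣ c') :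
    SameExtension f (X ^ p + C c') := by
  have hp := (Fact.out : p.Prime)
  have h2 := hp.two_le
  have := isAdicComplete_adjoinRoot hf hp.ne_zero
  obtain ⟨ε, hεu, hε, -⟩ := exists_natCast_eq_root_pow_mul hf hp.ne_zero (coeff_zero_eq hf)
  have h₁ := root_pow_dvd_of hf hp.ne_zero (N := 2 * p + 2) (i := 0) hc (by omega)
  have h₃ : AdjoinRoot.root f ^ (2 * p + 2) ∣
      (AdjoinRoot.root f * x) ^ p + AdjoinRoot.of f c' := by
    convert dvd_sub h h₁ using 1
    rw [map_sub]
    ring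
  obtain ⟨y, hy⟩ := exists_root_pow_add (AdjoinRoot.root f) hp hp2 hε hεu hx h₃
  -- The binomial is treated as a trinomial with zero middle coefficient.
  have hg := trinomial_mem_eisensteinPolys (l := 1) le_rfl hp.one_lt (dvd_zero (p : ℤ_[p])) hc' hc''
  rw [C_0, zero_mul, add_zero] at hg
  refine sameExtension_of_root hp.pos hf hg y ?_
  simpa [AdjoinRoot.algebraMap_eq] using hy

theorem dvd_and_not_sq_dvd_residue {x : ℤ_[p]} (h : (p : ℤ_[p]) ∣ x)
    (h' : ¬ (p : ℤ_[p]) ^ 2 ∣ x) :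
    (p : ℤ_[p]) ∣ residue x 3 ∧ ¬ (p : ℤ_[p]) ^ 2 ∣ residue x 3 := by
  have hr := pow_dvd_sub_residue x 3
  refine ⟨?_, fun hd => h' ?_⟩
  · have := dvd_sub h ((dvd_pow_self _ three_ne_zero).trans hr)
    rwa [sub_sub_cancel] at this
  · have := dvd_add ((pow_dvd_pow _ (by norm_num : 2 ≤ 3)).trans hr) hd
    rwa [sub_add_cancel] at this

theorem sameExtension_f₃ (hf : f ∈ eisensteinPolys p p) (hp2 : p ≠ 2) (h₀ : IsOfTypeZero f)
    (h : vp (f.coeff 1) ≠ 2) : SameExtension f (f₃ f) ∧ InAmanoTable (f₃ f) := by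
  have hp := (Fact.out : p.Prime)
  have h2 := hp.two_le
  obtain ⟨a, hap, ha⟩ := exists_residue_eq (sq_dvd_a₀'_sub hf)
  refine ⟨?_, Or.inr (Or.inr ⟨a, hap, by rw [f₃, ha]⟩)⟩
  have hd := root_pow_dvd_root_pow_add_sum hf (N := 2 * p + 2) (T := {0})
    (by simpa using hp.pos) (by
      intro i hi hi0
      rw [Finset.mem_singleton] at hi0
      rcases eq_or_ne i 1 with rfl | hi1
      · refine root_pow_dvd_of hf hp.ne_zero (k := 3) (pow_dvd_iff_le_vp.mpr ?_) (by omega)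
        have := (h₀ 1 le_rfl (by omega)).lt_of_ne' h
        exact Order.add_one_le_of_lt this
      · exact root_pow_dvd_of hf hp.ne_zero (k := 2)
          (pow_dvd_iff_le_vp.mpr (h₀ i (by omega) (by omega))) (by omega))
  rw [Finset.sum_singleton, pow_zero, mul_one] at hd
  obtain ⟨h₁, h₂⟩ := dvd_and_not_sq_dvd_of_sq_dvd_sub dvd_rfl not_sq_dvd_natCast
    (sq_dvd_a₀'_sub hf)
  obtain ⟨h₃, h₄⟩ := dvd_and_not_sq_dvd_residue h₁ h₂
  refine sameExtension_pow_add hf hp2 ((isUnit_u f).map (AdjoinRoot.of f)) ?_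
    (pow_dvd_sub_residue _ 3) h₃ h₄
  convert hd.mul_left (AdjoinRoot.of f (u f) ^ p) using 1
  rw [a₀', map_mul, map_pow]
  ring

/-- An approximate root of the binomial, for type zero with `p ^ 2` exactly dividing the linear
coefficient. -/
theorem exists_root_pow_dvd_add_a₀'' (hf : f ∈ eisensteinPolys p p) (hodd : Odd p)
    (h₀ : IsOfTypeZero f) (h : vp (f.coeff 1) = 2) :
    ∃ x : AdjoinRoot f, IsUnit x ∧ AdjoinRoot.root f ^ (2 * p + 2) ∣
      (AdjoinRoot.root f * x) ^ p + AdjoinRoot.of f (a₀'' f) := by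
  have hp := (Fact.out : p.Prime)
  have h2 := hp.two_le
  have := isAdicComplete_adjoinRoot hf hp.ne_zero
  obtain ⟨ε, -, hε, -⟩ := exists_natCast_eq_root_pow_mul hf hp.ne_zero (coeff_zero_eq hf)
  obtain ⟨d, hd⟩ := root_pow_dvd_root_pow_add_sum hf (N := 2 * p + 2) (T := {1, 0})
    (by intro i hi
        simp only [Finset.mem_insert, Finset.mem_singleton] at hi
        rw [Finset.mem_range]
        omega) (by
      intro i hi hiT
      simp only [Finset.mem_insert, Finset.mem_singleton, not_or] at hiT
      exact root_pow_dvd_of hf hp.ne_zero (k := 2)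
        (pow_dvd_iff_le_vp.mpr (h₀ i (by omega) (by omega))) (by omega))
  rw [Finset.sum_pair one_ne_zero, pow_zero, mul_one, pow_one] at hd
  have ha₀ := congrArg (AdjoinRoot.of f) (coeff_zero_eq hf)
  have ha₁ := congrArg (AdjoinRoot.of f) (eq_unitPart_mul_of_vp_eq (n := 2) h)
  have ha₀'' := congrArg (AdjoinRoot.of f) (a₀''.eq_1 f)
  -- With `t = -u₀⁻¹ u₁` and `p` odd, `a₀'' = a₀ (1 - t ^ p a₀)`.
  rw [← neg_neg (((unitPart (f.coeff 0))⁻¹ * unitPart (f.coeff 1) : ℤ_[p]ˣ) : ℤ_[p]),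
    hodd.neg_pow] at ha₀''
  have ht : AdjoinRoot.of f (unitPart (f.coeff 1) : ℤ_[p]) =
      -(AdjoinRoot.of f (unitPart (f.coeff 0) : ℤ_[p]) * AdjoinRoot.of f
        (-(((unitPart (f.coeff 0))⁻¹ * unitPart (f.coeff 1) : ℤ_[p]ˣ) : ℤ_[p]))) := by
    rw [← map_mul, ← map_neg]
    simp
  generalize -(((unitPart (f.coeff 0))⁻¹ * unitPart (f.coeff 1) : ℤ_[p]ˣ) : ℤ_[p]) = t at *
  simp only [map_mul, map_natCast, map_pow, map_add, map_neg, map_one] at ha₀ ha₁ ha₀''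
  -- The cross term `p π ^ (p + 1) t` is `≡ -p a₀ π t = a₁ π`, the term to be reproduced.
  refine ⟨1 + AdjoinRoot.root f * AdjoinRoot.of f t,
    isUnit_of_dvd_sub (AdjoinRoot.root f) isUnit_one ⟨_, add_sub_cancel_left _ _⟩, ?_⟩
  obtain ⟨q, hq⟩ := exists_add_pow_prime_eq hp 1 (AdjoinRoot.root f * AdjoinRoot.of f t)
  rw [mul_pow, hq, ha₀'', mul_pow]
  rw [pow_add, pow_mul'] at hd ⊢
  have hP : AdjoinRoot.root f ^ p = AdjoinRoot.root f * AdjoinRoot.root f ^ (p - 1) :=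
    (mul_pow_sub_one hp.ne_zero _).symm
  simp only [one_pow, one_mul]
  rw [ht] at ha₁
  generalize AdjoinRoot.of f (f.coeff 0) = A at *
  generalize AdjoinRoot.of f (f.coeff 1) = B at *
  generalize AdjoinRoot.of f (unitPart (f.coeff 0) : ℤ_[p]) = w at *
  generalize AdjoinRoot.of f t = τ at *
  generalize AdjoinRoot.root f = ϖ at *
  generalize ϖ ^ (p - 1) = J at *
  generalize τ ^ p = σ at *
  generalize (p : AdjoinRoot f) = n at *
  generalize ϖ ^ p = P at *
  subst hε ha₀ ha₁
  -- Thus `π ^ p + a₀` has order at least `2p + 1`, so replacing `π ^ p` by `-a₀` in the correction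
  -- terms is harmless.
  have hE : P + P * ε * w = P ^ 2 * ϖ * (ϖ * d + w * τ * ε ^ 2) := by linear_combination hd
  refine ⟨d + (P * ε * τ + σ * J * (1 - ε * w)) * (ϖ * d + w * τ * ε ^ 2) + ε * τ ^ 2 * q, ?_⟩
  linear_combination hd + (P * ε * τ * ϖ + σ * P * (1 - ε * w)) * hE +
    σ * (1 - ε * w) * P ^ 2 * ϖ * (ϖ * d + w * τ * ε ^ 2) * hP

theorem sq_dvd_a₀''_sub (hf : f ∈ eisensteinPolys p p) :
    (p : ℤ_[p]) ^ 2 ∣ a₀'' f - f.coeff 0 := by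
  obtain ⟨w, hw⟩ : (p : ℤ_[p]) ∣ f.coeff 0 := ⟨_, coeff_zero_eq hf⟩
  rw [a₀'']
  generalize (((unitPart (f.coeff 0))⁻¹ * unitPart (f.coeff 1) : ℤ_[p]ˣ) : ℤ_[p]) ^ p = t
  rw [hw]
  exact ⟨w ^ 2 * t, by ring⟩

theorem sameExtension_f₄ (hf : f ∈ eisensteinPolys p p) (hodd : Odd p) (h₀ : IsOfTypeZero f)
    (h : vp (f.coeff 1) = 2) : SameExtension f (f₄ f) := by
  obtain ⟨x, hx, hd⟩ := exists_root_pow_dvd_add_a₀'' hf hodd h₀ h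
  obtain ⟨h₁, h₂⟩ := dvd_and_not_sq_dvd_of_sq_dvd_sub ⟨_, coeff_zero_eq hf⟩
    (not_sq_dvd_coeff_zero hf) (sq_dvd_a₀''_sub hf)
  obtain ⟨h₃, h₄⟩ := dvd_and_not_sq_dvd_residue h₁ h₂
  exact sameExtension_pow_add hf (by rintro rfl; exact absurd hodd (by decide)) hx hd
    (pow_dvd_sub_residue _ 3) h₃ h₄

theorem sameExtension_f₄' (hf : f ∈ eisensteinPolys p p) (hodd : Odd p) (h₀ : IsOfTypeZero f)
    (h : vp (f.coeff 1) = 2) : SameExtension f (f₄' f) ∧ InAmanoTable (f₄' f) := by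
  obtain ⟨x, hx, hd⟩ := exists_root_pow_dvd_add_a₀'' hf hodd h₀ h
  obtain ⟨a, hap, ha⟩ := exists_residue_eq (sq_dvd_u_pow_mul_a₀''_sub hf)
  refine ⟨?_, Or.inr (Or.inr ⟨a, hap, by rw [f₄', ha]⟩)⟩
  obtain ⟨h₁, h₂⟩ := dvd_and_not_sq_dvd_of_sq_dvd_sub dvd_rfl not_sq_dvd_natCast
    (sq_dvd_u_pow_mul_a₀''_sub hf)
  obtain ⟨h₃, h₄⟩ := dvd_and_not_sq_dvd_residue h₁ h₂
  refine sameExtension_pow_add hf (by rintro rfl; exact absurd hodd (by decide))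
    (((isUnit_u f).map (AdjoinRoot.of f)).mul hx) ?_ (pow_dvd_sub_residue _ 3) h₃ h₄
  convert hd.mul_left (AdjoinRoot.of f (u f) ^ p) using 1
  rw [map_mul, map_pow]
  ring

end TypeZero

end EisensteinDegreeP

open EisensteinDegreeP in
theorem theorem1p16 (p : ℕ) [Fact p.Prime] (hp : Odd p)
    (f : ℤ_[p][X]) (hf : f ∈ eisensteinPolys p p) :
    (∀ l : ℕ, IsOfType f l →
      ((l ≠ p - 1 ∨ ¬ (p : ℤ_[p]) ∣ u' f l - (-1)) →
        SameExtension f (f₁ f l) ∧ InAmanoTable (f₁ f l)) ∧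
      ((l = p - 1 ∧ (p : ℤ_[p]) ∣ u' f l - (-1)) →
        SameExtension f (f₂ f) ∧ InAmanoTable (f₂ f))) ∧
    (IsOfTypeZero f →
      (vp (f.coeff 1) ≠ 2 →
        SameExtension f (f₃ f) ∧ InAmanoTable (f₃ f)) ∧
      (vp (f.coeff 1) = 2 →
        SameExtension f (f₄ f) ∧
        SameExtension f (f₄' f) ∧ InAmanoTable (f₄' f))) := by
  refine ⟨fun l hl => ⟨sameExtension_f₁ hf hl, ?_⟩, fun h₀ => ⟨?_, fun h =>
    ⟨sameExtension_f₄ hf hp h₀ h, sameExtension_f₄' hf hp h₀ h⟩⟩⟩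
  · rintro ⟨rfl, h⟩
    exact sameExtension_f₂ hf hl h
  · exact sameExtension_f₃ hf (by rintro rfl; exact absurd hp (by decide)) h₀
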